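/- Consider the Heckman selection-contaminated normal (SLcn) model: for $i=1,\dots,n$, $$Y_{1i}=\boldsymbol{x}_i^\top\boldsymbol\beta+\epsilon_{1i},\qquad Y_{2i}=\boldsymbol{w}_i^\top\boldsymbol\gamma+\epsilon_{2i},$$ with known covariates $\boldsymbol{x}_i\in\mathbb{R}^p$, $\boldsymbol{w}_i\in\mathbb{R}^q$ and independent, identically distributed errors $(\epsilon_{1i},\epsilon_{2i})^\top$ whose law is the contaminated normal mixture $$\nu_1\,\mathrm{N}_2(\boldsymbol 0,\nu_2^{-1}\boldsymbol\Sigma)+(1-\nu_1)\,\mathrm{N}_2(\boldsymbol 0,\boldsymbol\Sigma),\qquad \boldsymbol\Sigma=\begin{pmatrix}\sigma^2&\rho\sigma\\ \rho\sigma&1\end{pmatrix}.$$ The parameter is $\boldsymbol\theta=(\boldsymbol\beta,\boldsymbol\gamma,\sigma^2,\rho,\nu_1,\nu_2)$ with $\boldsymbol\beta\in\mathbb{R}^p$, $\boldsymbol\gamma\in\mathbb{R}^q$, $\sigma>0$, $-1<\rho<1$, $\nu_1,\nu_2\in(0,1)$. For each $i$ one observes $C_i=\mathbf 1\{Y_{2i}>0\}$,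 and $Y_{1i}$ if $C_i=1$; if $C_i=0$, the outcome is missing. **Theorem 1 (identifiability of the SLcn model).** For every parameter $\boldsymbol\theta$, the cdf $F(z)=P(\epsilon_{2i}\le z)$ of the error of the selection equation is $F(z)=\nu_1\Phi(z\mid 0,\nu_2^{-1})+(1-\nu_1)\Phi(z)$, where $\Phi(\cdot\mid 0,v)$ is the cdf of $\mathrm{N}(0,v)$ and $\Phi=\Phi(\cdot\mid 0,1)$, and $F$ satisfies the following three conditions. - *Condition 1.* For any $\delta>0$, the limit $\lim_{z\to-\infty}F(z)/e^{\delta z}$ exists and is $0$ or $+\infty$. - *Condition 2.* For any $\theta_0\in\mathbb{R}$, $\theta_1>0$, $\delta_1,\delta_2\ge 0$ with $\delta_1+\delta_2\ne 0$, the limit $$\lim_{z\to+\infty}\frac{F(\theta_0+\theta_1z)-F(z)}{e^{-\delta_1z^2-\delta_2z}}$$ exists and is $0$ or infinite; an infinite limit is $+\infty$ if $\theta_0+\theta_1z\ge z$ for all large $z$ (that is, $\theta_1>1$, or $\theta_1=1$ and $\theta_0\ge0$), and $-\infty$ otherwise. - *Condition 3.* For any $\theta_0\in\mathbb{R}$,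 $\theta_1>0$ and any integer $M\ge1$, at most one of the limits $$\lim_{z\to+\infty}z^M\{F(\theta_0+\theta_1z)-F(z)\}\quad\text{and}\quad\lim_{z\to-\infty}z^M\{1-F(\theta_0+\theta_1z)/F(z)\}$$ exists and is finite and positive. Moreover, the SLcn model is identifiable: if $n\ge1$ and the design matrices with rows $\boldsymbol{x}_i^\top$ and $\boldsymbol{w}_i^\top$ ($i=1,\dots,n$) have full column ranks $p$ and $q$, then two parameters in the parameter space that give the same joint law of the observed sample $\bigl(C_i,\ Y_{1i}\text{ if }C_i=1\bigr)_{i=1}^n$ are equal. -/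

import Mathlib

open MeasureTheory ProbabilityTheory Filter Topology Matrix

/-- The contaminated normal law with location `μ`, scale matrix `S`, mixing proportion `ν₁` and
degree of contamination `ν₂`: the mixture `ν₁ N(μ, ν₂⁻¹ S) + (1 - ν₁) N(μ, S)`. -/
noncomputable def contaminatedNormal {ι : Type*} [Fintype ι] [DecidableEq ι]
    (μ : EuclideanSpace ℝ ι) (S : Matrix ι ι ℝ) (ν₁ ν₂ : ℝ) : Measure (EuclideanSpace ℝ ι) :=
  ENNReal.ofReal ν₁ • multivariateGaussian μ (ν₂⁻¹ • S) +
    ENNReal.ofReal (1 - ν₁) • multivariateGaussian μ S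

/-- The parameter space of the selection-contaminated normal model with `p` covariates in the
outcome equation and `q` covariates in the selection equation. The bounds on `σ` and `ρ` say that
the dispersion matrix of the errors is positive definite. -/
@[ext]
structure SLcnParam (p q : ℕ) where
  /-- regression coefficients of the outcome equation -/
  β : Fin p → ℝ
  /-- regression coefficients of the selection equation -/
  γ : Fin q → ℝ
  /-- scale of the outcome error -/
  σ : ℝ
  /-- correlation of the two errors -/
  ρ : ℝ
  /-- mixing proportion -/
  ν₁ : ℝ
  /-- degree of contamination -/
  ν₂ : ℝ
  σ_pos : 0 < σ
  neg_one_lt_ρ : -1 < ρ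
  ρ_lt_one : ρ < 1
  ν₁_pos : 0 < ν₁
  ν₁_lt_one : ν₁ < 1
  ν₂_pos : 0 < ν₂
  ν₂_lt_one : ν₂ < 1

namespace SLcnParam

variable {p q n : ℕ}

/-- The dispersion matrix of the errors. -/
def dispersion (θ : SLcnParam p q) : Matrix (Fin 2) (Fin 2) ℝ :=
  !![θ.σ ^ 2, θ.ρ * θ.σ; θ.ρ * θ.σ, 1]

/-- The joint law of the errors `(ε₁, ε₂)` of the outcome equation and the selection equation. -/
noncomputable def errorLaw (θ : SLcnParam p q) : Measure (EuclideanSpace ℝ (Fin 2)) :=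
  contaminatedNormal 0 θ.dispersion θ.ν₁ θ.ν₂

/-- The distribution function `z ↦ P(ε₂ ≤ z)` of the error of the selection equation. -/
noncomputable def selectionErrorCDF (θ : SLcnParam p q) (z : ℝ) : ℝ :=
  θ.errorLaw.real {ε | ε 1 ≤ z}

/-- The latent response `(Y₁, Y₂) = (xᵀβ + ε₁, wᵀγ + ε₂)`. -/
noncomputable def response (θ : SLcnParam p q) (x : Fin p → ℝ) (w : Fin q → ℝ)
    (ε : EuclideanSpace ℝ (Fin 2)) : EuclideanSpace ℝ (Fin 2) :=
  !₂[x ⬝ᵥ θ.β + ε 0, w ⬝ᵥ θ.γ + ε 1]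

end SLcnParam

/-- What is observed of a latent response `(Y₁, Y₂)`: the selection indicator `C = 1{Y₂ > 0}`, and
the outcome `Y₁` if `C = 1`. The value `Sum.inl v` means `C = 1` and `Y₁ = v`; the value
`Sum.inr ()` means `C = 0` and a missing outcome. -/
noncomputable def observe (y : EuclideanSpace ℝ (Fin 2)) : ℝ ⊕ Unit :=
  if 0 < y 1 then Sum.inl (y 0) else Sum.inr ()

namespace SLcnParam

variable {p q n : ℕ}

/-- The law of the observation on one unit with covariates `x` and `w`. -/
noncomputable def unitLaw (θ : SLcnParam p q) (x : Fin p → ℝ) (w : Fin q → ℝ) :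
    Measure (ℝ ⊕ Unit) :=
  θ.errorLaw.map fun ε => observe (θ.response x w ε)

/-- The law of the observed sample of `n` independent units, where the rows of `X` and `W` are the
covariates of the units in the outcome equation and in the selection equation. -/
noncomputable def sampleLaw (X : Matrix (Fin n) (Fin p) ℝ) (W : Matrix (Fin n) (Fin q) ℝ)
    (θ : SLcnParam p q) : Measure (Fin n → ℝ ⊕ Unit) :=
  Measure.pi fun i => θ.unitLaw (X i) (W i)

end SLcnParam

/-- A statistical model is identifiable if different parameters give different laws of the data. -/
def IsIdentifiable {Θ Ω : Type*} [MeasurableSpace Ω] (law : Θ → Measure Ω) : Prop :=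
  Function.Injective law

/-- `F(z) / exp(δ z)` tends to `0` or to `+∞` as `z → -∞`, for every `δ > 0`. -/
def TailCondition1 (F : ℝ → ℝ) : Prop :=
  ∀ δ : ℝ, 0 < δ →
    Tendsto (fun z => F z / Real.exp (δ * z)) atBot (𝓝 0) ∨
    Tendsto (fun z => F z / Real.exp (δ * z)) atBot atTop

/-- `(F(θ₀ + θ₁ z) - F(z)) / exp(-δ₁ z² - δ₂ z)` tends to `0` or to infinity as `z → +∞`. The
infinite limit is `+∞` if `θ₀ + θ₁ z ≥ z` for large `z`, and `-∞` otherwise, since the numerator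
has that sign for large `z` when `F` is increasing. -/
def TailCondition2 (F : ℝ → ℝ) : Prop :=
  ∀ θ₀ θ₁ δ₁ δ₂ : ℝ, 0 < θ₁ → 0 ≤ δ₁ → 0 ≤ δ₂ → δ₁ + δ₂ ≠ 0 →
    Tendsto (fun z => (F (θ₀ + θ₁ * z) - F z) / Real.exp (-δ₁ * z ^ 2 - δ₂ * z)) atTop (𝓝 0) ∨
    ((1 < θ₁ ∨ (θ₁ = 1 ∧ 0 ≤ θ₀)) ∧
      Tendsto (fun z => (F (θ₀ + θ₁ * z) - F z) / Real.exp (-δ₁ * z ^ 2 - δ₂ * z)) atTop atTop) ∨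
    ((θ₁ < 1 ∨ (θ₁ = 1 ∧ θ₀ < 0)) ∧
      Tendsto (fun z => (F (θ₀ + θ₁ * z) - F z) / Real.exp (-δ₁ * z ^ 2 - δ₂ * z)) atTop atBot)

/-- At most one of the limits of `z ^ M (F(θ₀ + θ₁ z) - F(z))` as `z → +∞` and of
`z ^ M (1 - F(θ₀ + θ₁ z) / F(z))` as `z → -∞` exists as a finite positive number. -/
def TailCondition3 (F : ℝ → ℝ) : Prop :=
  ∀ (θ₀ θ₁ : ℝ) (M : ℕ), 0 < θ₁ → 0 < M →
    ¬ ((∃ l : ℝ, 0 < l ∧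
          Tendsto (fun z => z ^ M * (F (θ₀ + θ₁ * z) - F z)) atTop (𝓝 l)) ∧
       (∃ l : ℝ, 0 < l ∧
          Tendsto (fun z => z ^ M * (1 - F (θ₀ + θ₁ * z) / F z)) atBot (𝓝 l)))

/-! Everything is read off from tails of the form `C * exp (-(a * y ^ 2 + b * y)) / y ^ e`. Such
tails are closed under products and affine substitutions. The lexicographic order of `(a, b)`
decides which of two tails dominates, and the quadruple `(a, b, e, C)` is determined by the function
(`HasGaussTail.unique`).

Tail conditions: since `√ν₂ < 1`, the wide component dominates both tails of the selection error,
and Mills' ratio gives each tail the parameters `(ν₂ / 2, 0, 1)`. Conditions 1 and 3 follow because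
Gaussian decay beats every exponential and every power. Condition 2 follows because a difference of
two such tails is, up to sign, governed by the heavier one.

Identifiability does not go through these conditions. On the selected event the outcome of a unit
with locations `μ`, `m` has density `ν₁ k φ(k(y-μ)) Φ(√ν₂ m/r + (ρ/r) k (y-μ))` plus a narrower term
of the same shape, where `k = √ν₂/σ` and `r = √(1-ρ²)`. At `+∞` the factor `Φ` tends to 1, is
constant, or decays like Mills' ratio according as `ρ` is positive, zero or negative, so the
exponent `e` and the reflection `y ↦ -y` reveal the sign of `ρ`. If `ρ > 0`, the right tail gives
`k`, `μ`, `ν₁`, and the left tail gives `ρ` and `√ν₂ m`. The wide components then cancel, and the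
tail of what is left gives `σ`, hence `ν₂` and `m`. The case `ρ < 0` is its mirror image. If `ρ =
0`, the same peeling yields only `ν₁ Φ(√ν₂ m)` and `(1-ν₁) Φ(m)`, and monotonicity of `Φ` separates
`ν₁` from `m` (`mixing_eq`). Full column rank turns the locations into `β` and `γ`. -/

/-! ### Calculus of Gaussian-type tails -/

/-- As `y → +∞`, `g y ~ C * exp (-(a * y ^ 2 + b * y)) / y ^ e`, with a positive constant `C`. -/
def HasGaussTail (g : ℝ → ℝ) (a b : ℝ) (e : ℕ) (C : ℝ) : Prop :=
  0 < C ∧ Tendsto (fun y => g y * (Real.exp (a * y ^ 2 + b * y) * y ^ e)) atTop (𝓝 C)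

/-- As `y → +∞`, `g y = o(exp (-(a * y ^ 2 + b * y)) / y ^ e)`. -/
def IsGaussNegligible (g : ℝ → ℝ) (a b : ℝ) (e : ℕ) : Prop :=
  Tendsto (fun y => g y * (Real.exp (a * y ^ 2 + b * y) * y ^ e)) atTop (𝓝 0)

lemma tendsto_quadratic_atTop {a b : ℝ} (h : 0 < a ∨ (a = 0 ∧ 0 < b)) :
    Tendsto (fun y : ℝ => a * y ^ 2 + b * y) atTop atTop := by
  rcases h with h | ⟨rfl, h⟩
  · have h1 : Tendsto (fun y : ℝ => y * (a * y + b)) atTop atTop :=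
      tendsto_id.atTop_mul_atTop₀ (tendsto_atTop_add_const_right _ _ (tendsto_id.const_mul_atTop h))
    exact h1.congr fun y => by ring
  · simpa using tendsto_id.const_mul_atTop h

lemma tendsto_exp_neg_quadratic_mul_pow {a b : ℝ} (h : 0 < a ∨ (a = 0 ∧ 0 < b)) (n : ℕ) :
    Tendsto (fun y : ℝ => Real.exp (-(a * y ^ 2 + b * y)) * y ^ n) atTop (𝓝 0) := by
  -- A linear minorant of the exponent reduces the claim to `t ^ n * exp (-t) → 0`.
  obtain ⟨c, hc, hle⟩ : ∃ c : ℝ, 0 < c ∧ ∀ᶠ y : ℝ in atTop, c * y ≤ a * y ^ 2 + b * y := by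
    rcases h with h | ⟨rfl, h⟩
    · refine ⟨1, one_pos, ?_⟩
      have h1 : Tendsto (fun y : ℝ => a * y ^ 2 + (b - 1) * y) atTop atTop :=
        tendsto_quadratic_atTop (Or.inl h)
      filter_upwards [h1.eventually_ge_atTop 0] with y hy
      linarith
    · exact ⟨b, h, Eventually.of_forall fun y => by simp⟩
  have h1 := (Real.tendsto_pow_mul_exp_neg_atTop_nhds_zero n).comp
    (tendsto_id.const_mul_atTop hc)
  have h2 : Tendsto (fun y : ℝ => (c ^ n)⁻¹ * ((c * y) ^ n * Real.exp (-(c * y)))) atTop (𝓝 0) := by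
    simpa using h1.const_mul (c ^ n)⁻¹
  refine squeeze_zero' ?_ ?_ h2
  · filter_upwards [eventually_ge_atTop 0] with y hy
    positivity
  · filter_upwards [eventually_ge_atTop 0, hle] with y hy h3
    have : (c ^ n)⁻¹ * ((c * y) ^ n * Real.exp (-(c * y))) = Real.exp (-(c * y)) * y ^ n := by
      rw [mul_pow]
      field_simp
    rw [this]
    gcongr

lemma IsGaussNegligible.neg {g : ℝ → ℝ} {a b : ℝ} {e : ℕ} (h : IsGaussNegligible g a b e) :
    IsGaussNegligible (fun y => -g y) a b e := by
  have := Tendsto.neg h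
  rw [neg_zero] at this
  exact this.congr fun y => by ring

namespace HasGaussTail

variable {g h : ℝ → ℝ} {a b a' b' C C' : ℝ} {e e' : ℕ}

lemma eventually_ne (hg : HasGaussTail g a b e C) : ∀ᶠ y in atTop, g y ≠ 0 := by
  filter_upwards [hg.2.eventually (lt_mem_nhds hg.1)] with y hy h0
  simp [h0] at hy

lemma of_tendsto (hC : 0 < C) (hg : Tendsto g atTop (𝓝 C)) : HasGaussTail g 0 0 0 C :=
  ⟨hC, by simpa using hg⟩

lemma mul (hg : HasGaussTail g a b e C) (hh : HasGaussTail h a' b' e' C') :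
    HasGaussTail (fun y => g y * h y) (a + a') (b + b') (e + e') (C * C') := by
  refine ⟨mul_pos hg.1 hh.1, (hg.2.mul hh.2).congr fun y => ?_⟩
  rw [show (a + a') * y ^ 2 + (b + b') * y = (a * y ^ 2 + b * y) + (a' * y ^ 2 + b' * y) by ring,
    Real.exp_add (a * y ^ 2 + b * y), pow_add]
  ring

lemma const_mul {c : ℝ} (hc : 0 < c) (hg : HasGaussTail g a b e C) :
    HasGaussTail (fun y => c * g y) a b e (c * C) :=
  ⟨mul_pos hc hg.1, (hg.2.const_mul c).congr fun y => by ring⟩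

/-- Expanding the quadratic at `α + β * y` produces the new coefficients; its constant term and the
limit `1 / β` of `y / (α + β * y)` go into the new constant. -/
lemma comp_affine (hg : HasGaussTail g a b e C) (α : ℝ) {β : ℝ} (hβ : 0 < β) :
    HasGaussTail (fun y => g (α + β * y)) (a * β ^ 2) (2 * a * α * β + b * β) e
      (C * (Real.exp (-(a * α ^ 2 + b * α)) / β ^ e)) := by
  have haff : Tendsto (fun y : ℝ => α + β * y) atTop atTop :=
    tendsto_atTop_add_const_left _ _ (tendsto_id.const_mul_atTop hβ)
  have hquot : Tendsto (fun y : ℝ => (y / (α + β * y)) ^ e) atTop (𝓝 ((1 / β) ^ e)) := by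
    apply Tendsto.pow
    have h1 : Tendsto (fun y : ℝ => 1 / (α / y + β)) atTop (𝓝 (1 / β)) := by
      apply tendsto_const_nhds.div _ hβ.ne'
      simpa using (tendsto_const_nhds.div_atTop tendsto_id).add_const β
    refine h1.congr' ?_
    filter_upwards [eventually_gt_atTop 0] with y hy
    rw [show α / y + β = (α + β * y) / y by field_simp, one_div_div]
  refine ⟨by have := hg.1; positivity, ?_⟩
  have h2 := ((hg.2.comp haff).mul hquot).mul_const (Real.exp (-(a * α ^ 2 + b * α)))
  rw [show C * (Real.exp (-(a * α ^ 2 + b * α)) / β ^ e) =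
    C * (1 / β) ^ e * Real.exp (-(a * α ^ 2 + b * α)) by rw [one_div, inv_pow]; ring]
  refine h2.congr' ?_
  filter_upwards [haff.eventually_gt_atTop 0] with y hy
  have h3 : Real.exp (a * β ^ 2 * y ^ 2 + (2 * a * α * β + b * β) * y) =
      Real.exp (a * (α + β * y) ^ 2 + b * (α + β * y)) * Real.exp (-(a * α ^ 2 + b * α)) := by
    rw [← Real.exp_add]; congr 1; ring
  simp only [Function.comp_apply]
  rw [h3, div_pow]
  field_simp

/-- A lexicographically larger `(a', b')` wins by at least an exponential factor, so neither power
of `y` matters. -/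
lemma isGaussNegligible (hh : HasGaussTail h a' b' e' C') (hlt : a < a' ∨ (a = a' ∧ b < b'))
    (e : ℕ) : IsGaussNegligible h a b e := by
  have h1 := tendsto_exp_neg_quadratic_mul_pow (a := a' - a) (b := b' - b)
    (hlt.imp (fun h => sub_pos.2 h) fun h => ⟨sub_eq_zero.2 h.1.symm, sub_pos.2 h.2⟩) e
  have h2 : Tendsto (fun y : ℝ => (y ^ e')⁻¹ * (Real.exp (-((a' - a) * y ^ 2 + (b' - b) * y)) * y ^ e))
      atTop (𝓝 0) := by
    refine squeeze_zero' ?_ ?_ h1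
    · filter_upwards [eventually_ge_atTop 0] with y hy
      positivity
    · filter_upwards [eventually_ge_atTop 1] with y hy
      exact mul_le_of_le_one_left (by positivity) (inv_le_one_of_one_le₀ (one_le_pow₀ hy))
  have h3 := hh.2.mul h2
  rw [mul_zero] at h3
  refine h3.congr' ?_
  filter_upwards [eventually_gt_atTop 0] with y hy
  have h4 : Real.exp (a * y ^ 2 + b * y) = Real.exp (a' * y ^ 2 + b' * y) *
      Real.exp (-((a' - a) * y ^ 2 + (b' - b) * y)) := by
    rw [← Real.exp_add]; congr 1; ring
  rw [h4]
  field_simp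

lemma add_negligible (hg : HasGaussTail g a b e C) (hh : IsGaussNegligible h a b e) :
    HasGaussTail (fun y => g y + h y) a b e C := by
  have h1 := hg.2.add hh
  rw [add_zero] at h1
  exact ⟨hg.1, h1.congr fun y => by ring⟩

/-- The logarithm of the quotient of the two normalizers is a combination of `y ^ 2`, `y` and `log
y` with a finite limit. Dividing in turn by `y ^ 2`, `y` and `log y` kills the three coefficients.
-/
theorem unique (hg : HasGaussTail g a b e C) (hg' : HasGaussTail g a' b' e' C') :
    a = a' ∧ b = b' ∧ e = e' ∧ C = C' := by
  have hlog : Tendsto (fun y : ℝ => (a - a') * y ^ 2 + (b - b') * y + ((e : ℝ) - e') * Real.log y)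
      atTop (𝓝 (Real.log (C / C'))) := by
    have h1 := (hg.2.div hg'.2 hg'.1.ne').log (div_pos hg.1 hg'.1).ne'
    refine h1.congr' ?_
    filter_upwards [eventually_gt_atTop 0, hg.eventually_ne] with y hy hne
    rw [Pi.div_apply, mul_div_mul_left _ _ hne, Real.log_div (by positivity) (by positivity),
      Real.log_mul (by positivity) (by positivity), Real.log_mul (by positivity) (by positivity),
      Real.log_exp, Real.log_exp, Real.log_pow, Real.log_pow]
    ring
  have hlogy : Tendsto (fun y : ℝ => Real.log y / y) atTop (𝓝 0) := by
    simpa using Real.tendsto_pow_log_div_mul_add_atTop 1 0 1 one_ne_zero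
  have hinv : Tendsto (fun y : ℝ => y⁻¹) atTop (𝓝 0) := tendsto_inv_atTop_zero
  have ha : a - a' = 0 := by
    have h1 : Tendsto (fun y : ℝ => ((a - a') * y ^ 2 + (b - b') * y +
        ((e : ℝ) - e') * Real.log y) * (y⁻¹ * y⁻¹)) atTop (𝓝 0) := by
      simpa using hlog.mul (hinv.mul hinv)
    have h2 : Tendsto (fun y : ℝ => (a - a') + (b - b') * y⁻¹ +
        ((e : ℝ) - e') * (Real.log y / y * y⁻¹)) atTop (𝓝 (a - a')) := by
      simpa using ((hinv.const_mul (b - b')).const_add (a - a')).add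
        ((hlogy.mul hinv).const_mul ((e : ℝ) - e'))
    refine tendsto_nhds_unique (h2.congr' ?_) h1
    filter_upwards [eventually_gt_atTop 0] with y hy
    field_simp
  simp only [ha, zero_mul, zero_add] at hlog
  have hb : b - b' = 0 := by
    have h1 : Tendsto (fun y : ℝ => ((b - b') * y + ((e : ℝ) - e') * Real.log y) * y⁻¹)
        atTop (𝓝 0) := by
      simpa using hlog.mul hinv
    have h2 : Tendsto (fun y : ℝ => (b - b') + ((e : ℝ) - e') * (Real.log y / y))
        atTop (𝓝 (b - b')) := by
      simpa using (hlogy.const_mul ((e : ℝ) - e')).const_add (b - b')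
    refine tendsto_nhds_unique (h2.congr' ?_) h1
    filter_upwards [eventually_gt_atTop 0] with y hy
    field_simp
  simp only [hb, zero_mul, zero_add] at hlog
  have he : (e : ℝ) - e' = 0 := by
    have h1 : Tendsto (fun y : ℝ => ((e : ℝ) - e') * Real.log y * (Real.log y)⁻¹) atTop (𝓝 0) := by
      simpa using hlog.mul (tendsto_inv_atTop_zero.comp Real.tendsto_log_atTop)
    refine tendsto_nhds_unique (tendsto_const_nhds.congr' ?_) h1
    filter_upwards [eventually_gt_atTop 1] with y hy
    have := Real.log_pos hy
    field_simp
  obtain rfl : a = a' := sub_eq_zero.1 ha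
  obtain rfl : b = b' := sub_eq_zero.1 hb
  obtain rfl : e = e' := by exact_mod_cast sub_eq_zero.1 he
  exact ⟨rfl, rfl, rfl, tendsto_nhds_unique hg.2 hg'.2⟩

end HasGaussTail

/-! ### The standard normal distribution function and Mills' ratio -/

/-- The standard normal distribution function. -/
noncomputable def stdNormalCDF (x : ℝ) : ℝ := cdf (gaussianReal 0 1) x

/-- The standard normal density. -/
noncomputable def stdNormalPDF (x : ℝ) : ℝ := (√(2 * Real.pi))⁻¹ * Real.exp (-(x ^ 2 / 2))

lemma gaussianPDFReal_zero_one : gaussianPDFReal 0 1 = stdNormalPDF := by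
  ext x
  simp [gaussianPDFReal, stdNormalPDF, neg_div]

lemma stdNormalPDF_pos (x : ℝ) : 0 < stdNormalPDF x := by
  unfold stdNormalPDF
  positivity

lemma continuous_stdNormalPDF : Continuous stdNormalPDF := by
  unfold stdNormalPDF
  fun_prop

lemma stdNormalCDF_eq_integral (x : ℝ) :
    stdNormalCDF x = ∫ t in Set.Iic x, stdNormalPDF t := by
  rw [stdNormalCDF, cdf_eq_real, Measure.real, gaussianReal_apply_eq_integral _ one_ne_zero,
    gaussianPDFReal_zero_one, ENNReal.toReal_ofReal]
  exact setIntegral_nonneg measurableSet_Iic fun t _ => (stdNormalPDF_pos t).le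

lemma hasDerivAt_stdNormalCDF (x : ℝ) : HasDerivAt stdNormalCDF (stdNormalPDF x) x := by
  have hint : Integrable stdNormalPDF := by
    rw [← gaussianPDFReal_zero_one]
    exact integrable_gaussianPDFReal 0 1
  have h1 : stdNormalCDF = fun x => stdNormalCDF 0 + ∫ t in (0 : ℝ)..x, stdNormalPDF t := by
    ext x
    rw [← intervalIntegral.integral_Iic_sub_Iic hint.integrableOn hint.integrableOn,
      stdNormalCDF_eq_integral, stdNormalCDF_eq_integral]
    ring
  rw [h1]
  exact (intervalIntegral.integral_hasDerivAt_right (hint.intervalIntegrable)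
    (continuous_stdNormalPDF.stronglyMeasurableAtFilter _ _)
    continuous_stdNormalPDF.continuousAt).const_add _

lemma continuous_stdNormalCDF : Continuous stdNormalCDF :=
  continuous_iff_continuousAt.2 fun x => (hasDerivAt_stdNormalCDF x).continuousAt

lemma strictMono_stdNormalCDF : StrictMono stdNormalCDF :=
  strictMono_of_hasDerivAt_pos hasDerivAt_stdNormalCDF stdNormalPDF_pos

lemma stdNormalCDF_pos (x : ℝ) : 0 < stdNormalCDF x :=
  (cdf_nonneg _ (x - 1)).trans_lt (strictMono_stdNormalCDF (sub_one_lt x))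

lemma stdNormalCDF_neg (x : ℝ) : stdNormalCDF (-x) = 1 - stdNormalCDF x := by
  have hd : ∀ y : ℝ, HasDerivAt (fun y => stdNormalCDF (-y) + stdNormalCDF y) 0 y := by
    intro y
    have h1 := ((hasDerivAt_stdNormalCDF (-y)).comp y (hasDerivAt_neg y)).add
      (hasDerivAt_stdNormalCDF y)
    have h2 : stdNormalPDF (-y) * -1 + stdNormalPDF y = 0 := by simp [stdNormalPDF]
    rw [h2] at h1
    exact h1
  have hconst : ∀ y, stdNormalCDF (-y) + stdNormalCDF y = stdNormalCDF (-x) + stdNormalCDF x :=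
    fun y => is_const_of_deriv_eq_zero (fun y => (hd y).differentiableAt)
      (fun y => (hd y).deriv) y x
  have hlim : Tendsto (fun y => stdNormalCDF (-y) + stdNormalCDF y) atTop (𝓝 (0 + 1)) :=
    ((tendsto_cdf_atBot _).comp tendsto_neg_atTop_atBot).add (tendsto_cdf_atTop _)
  have := tendsto_nhds_unique hlim (tendsto_const_nhds.congr fun y => (hconst y).symm)
  linarith

lemma hasGaussTail_stdNormalPDF : HasGaussTail stdNormalPDF (1 / 2) 0 0 (√(2 * Real.pi))⁻¹ := by
  refine ⟨by positivity, tendsto_const_nhds.congr fun y => ?_⟩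
  rw [stdNormalPDF, pow_zero, mul_one, mul_assoc, ← Real.exp_add]
  ring_nf
  simp

/-- Asymptotics of Mills' ratio. -/
lemma hasGaussTail_stdNormalCDF_neg :
    HasGaussTail (fun y => stdNormalCDF (-y)) (1 / 2) 0 1 (√(2 * Real.pi))⁻¹ := by
  refine ⟨by positivity, ?_⟩
  set c := (√(2 * Real.pi))⁻¹ with hc
  have hE : ∀ y : ℝ, HasDerivAt (fun y : ℝ => Real.exp (-(y ^ 2 / 2)))
      (-y * Real.exp (-(y ^ 2 / 2))) y := by
    intro y
    have := (((hasDerivAt_pow 2 y).div_const 2).neg).exp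
    refine this.congr_deriv ?_
    simp only [Pi.neg_apply]
    push_cast
    ring
  have hg : ∀ᶠ y : ℝ in atTop, HasDerivAt (fun y : ℝ => Real.exp (-(y ^ 2 / 2)) / y)
      (-(Real.exp (-(y ^ 2 / 2)) * (1 + (y⁻¹) ^ 2))) y := by
    filter_upwards [eventually_gt_atTop 0] with y hy
    refine ((hE y).div (hasDerivAt_id y) hy.ne').congr_deriv ?_
    simp only [id]
    field_simp
    ring
  -- L'Hôpital against `exp (-y²/2) / y`: the quotient of derivatives is `c / (1 + y⁻²)`, which
  -- tends to `c`.
  have h := HasDerivAt.lhopital_zero_atTop (l := 𝓝 c)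
    (Eventually.of_forall fun y => (hasDerivAt_stdNormalCDF (-y)).comp y (hasDerivAt_neg y)) hg
    (Eventually.of_forall fun y => by
      have : 0 < Real.exp (-(y ^ 2 / 2)) * (1 + (y⁻¹) ^ 2) := by positivity
      linarith)
    ((tendsto_cdf_atBot _).comp tendsto_neg_atTop_atBot)
    (by
      have h1 := tendsto_exp_neg_quadratic_mul_pow (a := 1 / 2) (b := 0) (by norm_num) 0
      have h2 := h1.mul tendsto_inv_atTop_zero
      rw [zero_mul] at h2
      refine h2.congr fun y => ?_
      rw [div_eq_mul_inv, pow_zero, mul_one]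
      congr 3
      ring)
    (by
      have h1 : Tendsto (fun y : ℝ => c / (1 + (y⁻¹) ^ 2)) atTop (𝓝 (c / (1 + 0 ^ 2))) :=
        tendsto_const_nhds.div (tendsto_const_nhds.add (tendsto_inv_atTop_zero.pow 2)) (by norm_num)
      norm_num at h1
      refine h1.congr fun y => ?_
      simp only [stdNormalPDF, ← hc, neg_sq]
      have := Real.exp_pos (-(y ^ 2 / 2))
      have h3 : (1 + (y⁻¹) ^ 2) ≠ 0 := by positivity
      rw [mul_neg_one, neg_div_neg_eq, mul_comm c, mul_div_mul_left _ _ this.ne']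
      simp)
  refine h.congr' ?_
  filter_upwards [eventually_gt_atTop 0] with y hy
  have h4 : Real.exp (1 / 2 * y ^ 2 + 0 * y) = (Real.exp (-(y ^ 2 / 2)))⁻¹ := by
    rw [← Real.exp_neg]; congr 1; ring
  rw [h4]
  simp only [Function.comp_apply]
  have := Real.exp_pos (-(y ^ 2 / 2))
  field_simp

/-! ### Tail conditions from tail asymptotics -/

/-- The exponent `e = 1` is essential: when `(δ₁, δ₂) = (a, b)`, the factor `1 / z` sends the
quotient to `0` instead of to a positive constant. -/
lemma HasGaussTail.div_exp_tendsto_zero_or_atTop {g : ℝ → ℝ} {a b C : ℝ}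
    (hg : HasGaussTail g a b 1 C) (δ₁ δ₂ : ℝ) :
    Tendsto (fun z => g z / Real.exp (-δ₁ * z ^ 2 - δ₂ * z)) atTop (𝓝 0) ∨
    Tendsto (fun z => g z / Real.exp (-δ₁ * z ^ 2 - δ₂ * z)) atTop atTop := by
  have hdiv : ∀ z, g z / Real.exp (-δ₁ * z ^ 2 - δ₂ * z) =
      g z * Real.exp (δ₁ * z ^ 2 + δ₂ * z) := by
    intro z
    rw [div_eq_mul_inv, ← Real.exp_neg]
    congr 2
    ring
  simp only [hdiv]
  by_cases hlt : δ₁ < a ∨ (δ₁ = a ∧ δ₂ < b)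
  · left
    simpa [IsGaussNegligible] using hg.isGaussNegligible hlt 0
  by_cases heq : δ₁ = a ∧ δ₂ = b
  · left
    obtain ⟨rfl, rfl⟩ := heq
    have h1 := hg.2.mul tendsto_inv_atTop_zero
    rw [mul_zero] at h1
    refine h1.congr' ?_
    filter_upwards [eventually_gt_atTop 0] with z hz
    field_simp
  right
  have hgt : 0 < δ₁ - a ∨ (δ₁ - a = 0 ∧ 0 < δ₂ - b) := by
    rcases lt_trichotomy δ₁ a with h | h | h
    · exact absurd (Or.inl h) hlt
    · refine Or.inr ⟨sub_eq_zero.2 h, sub_pos.2 ?_⟩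
      rcases lt_trichotomy δ₂ b with h' | h' | h'
      · exact absurd (Or.inr ⟨h, h'⟩) hlt
      · exact absurd ⟨h, h'⟩ heq
      · exact h'
    · exact Or.inl (sub_pos.2 h)
  have h1 : Tendsto (fun y : ℝ => (Real.exp (-((δ₁ - a) * y ^ 2 + (δ₂ - b) * y)) * y ^ 1)⁻¹)
      atTop atTop := by
    apply Tendsto.inv_tendsto_nhdsGT_zero
    refine tendsto_nhdsWithin_iff.2 ⟨tendsto_exp_neg_quadratic_mul_pow hgt 1, ?_⟩
    filter_upwards [eventually_gt_atTop 0] with y hy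
    exact Set.mem_Ioi.2 (by positivity)
  refine (hg.2.pos_mul_atTop hg.1 h1).congr' ?_
  filter_upwards [eventually_gt_atTop 0] with z hz
  have h4 : Real.exp (δ₁ * z ^ 2 + δ₂ * z) = Real.exp (a * z ^ 2 + b * z) *
      (Real.exp (-((δ₁ - a) * z ^ 2 + (δ₂ - b) * z)))⁻¹ := by
    rw [← Real.exp_neg, ← Real.exp_add]; congr 1; ring
  rw [h4]
  field_simp

lemma tailCondition1_of_hasGaussTail {F : ℝ → ℝ} {a b C : ℝ} {e : ℕ} (ha : 0 < a)
    (hF : HasGaussTail (fun z => F (-z)) a b e C) : TailCondition1 F := by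
  intro δ _
  left
  have h1 := Tendsto.comp (hF.isGaussNegligible (a := 0) (b := δ) (Or.inl ha) 0)
    tendsto_neg_atBot_atTop
  refine h1.congr fun z => ?_
  simp [div_eq_mul_inv, ← Real.exp_neg]

/-- The increment of `F` is a difference of two upper tails, with parameters `(a, 0)` and `(a θ₁², 2
a θ₀ θ₁)`. Unless the affine map is the identity, one is negligible against the other, and the
heavier one fixes rate and sign. -/
lemma tailCondition2_of_hasGaussTail {F : ℝ → ℝ} {a C : ℝ} (ha : 0 < a)
    (hF : HasGaussTail (fun z => 1 - F z) a 0 1 C) : TailCondition2 F := by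
  intro θ₀ θ₁ δ₁ δ₂ hθ₁ _ _ _
  have haff := hF.comp_affine θ₀ hθ₁
  by_cases h0 : θ₁ = 1 ∧ θ₀ = 0
  · left
    simp [h0.1, h0.2]
  by_cases hgt : 1 < θ₁ ∨ (θ₁ = 1 ∧ 0 ≤ θ₀)
  · have hneg := haff.isGaussNegligible (a := a) (b := 0) (by
      rcases hgt with h | ⟨h, h'⟩
      · exact Or.inl (lt_mul_of_one_lt_right ha (one_lt_pow₀ h two_ne_zero))
      · have : 0 < θ₀ := lt_of_le_of_ne h' fun h'' => h0 ⟨h, h''.symm⟩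
        subst h
        exact Or.inr ⟨by ring, by positivity⟩) 1
    have hdiff := hF.add_negligible hneg.neg
    have heq : (fun y => 1 - F y + -(1 - F (θ₀ + θ₁ * y))) = fun y => F (θ₀ + θ₁ * y) - F y := by
      ext y; ring
    rw [heq] at hdiff
    exact (hdiff.div_exp_tendsto_zero_or_atTop δ₁ δ₂).imp_right fun h => Or.inl ⟨hgt, h⟩
  · have hlt : θ₁ < 1 ∨ (θ₁ = 1 ∧ θ₀ < 0) := by
      push Not at hgt
      rcases hgt.1.lt_or_eq with h | h
      · exact Or.inl h
      · exact Or.inr ⟨h, hgt.2 h⟩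
    have hneg := hF.isGaussNegligible (a := a * θ₁ ^ 2) (b := 2 * a * θ₀ * θ₁ + 0 * θ₁) (by
      rcases hlt with h | ⟨h, h'⟩
      · exact Or.inl (mul_lt_of_lt_one_right ha (pow_lt_one₀ hθ₁.le h two_ne_zero))
      · subst h
        exact Or.inr ⟨by ring, by nlinarith⟩) 1
    have hdiff := haff.add_negligible hneg.neg
    refine (hdiff.div_exp_tendsto_zero_or_atTop δ₁ δ₂).imp (fun h => ?_) fun h => Or.inr ⟨hlt, ?_⟩
    · have := h.neg
      rw [neg_zero] at this
      exact this.congr fun z => by ring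
    · exact (tendsto_neg_atTop_atBot.comp h).congr fun z => by
        simp only [Function.comp_apply]; ring

/-- The limit at `+∞` is always `0`, so it is never positive and the one at `-∞` plays no role. -/
lemma tailCondition3_of_hasGaussTail {F : ℝ → ℝ} {a b C : ℝ} {e : ℕ} (ha : 0 < a)
    (hF : HasGaussTail (fun z => 1 - F z) a b e C) : TailCondition3 F := by
  rintro θ₀ θ₁ M hθ₁ - ⟨⟨l, hl, hlim⟩, -⟩
  have h1 : IsGaussNegligible (fun z => 1 - F z) 0 0 M := hF.isGaussNegligible (Or.inl ha) M
  have h2 := (hF.comp_affine θ₀ hθ₁).isGaussNegligible (a := 0) (b := 0)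
    (Or.inl (by positivity)) M
  have h3 := Tendsto.sub h1 h2
  rw [sub_zero] at h3
  refine hl.ne (tendsto_nhds_unique (h3.congr fun z => ?_) hlim)
  simp
  ring

/-! ### The law of the selection error -/

lemma gaussianReal_eq_map_affine (μ s : ℝ) (v : NNReal) (hv : (v : ℝ) = s ^ 2) :
    gaussianReal μ v = (gaussianReal 0 1).map fun z => μ + s * z := by
  have h1 : (fun z : ℝ => μ + s * z) = (fun z => μ + z) ∘ fun z => s * z := rfl
  rw [h1, ← Measure.map_map (by fun_prop) (by fun_prop), gaussianReal_map_const_mul,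
    gaussianReal_map_const_add]
  congr 1
  · simp
  · ext
    simp [hv]

lemma cdf_gaussianReal_zero {s : ℝ} (hs : 0 < s) (v : NNReal) (hv : (v : ℝ) = s⁻¹ ^ 2) (z : ℝ) :
    cdf (gaussianReal 0 v) z = stdNormalCDF (s * z) := by
  rw [stdNormalCDF, cdf_eq_real, cdf_eq_real, gaussianReal_eq_map_affine 0 s⁻¹ v hv,
    map_measureReal_apply (by fun_prop) measurableSet_Iic]
  congr 1
  ext t
  simp only [Set.mem_preimage, Set.mem_Iic, zero_add]
  rw [inv_mul_le_iff₀ hs]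

/-- The component with the smaller factor `s < 1` has the heavier tail and absorbs the other. -/
lemma hasGaussTail_stdNormalCDF_mixture {w s : ℝ} (hw : 0 < w) (hw' : w < 1) (hs : 0 < s)
    (hs' : s < 1) :
    ∃ C, HasGaussTail (fun z => w * stdNormalCDF (-(s * z)) + (1 - w) * stdNormalCDF (-z))
      (s ^ 2 / 2) 0 1 C := by
  have h1 := (hasGaussTail_stdNormalCDF_neg.comp_affine 0 hs).const_mul hw
  have h2 := (hasGaussTail_stdNormalCDF_neg.const_mul (sub_pos.2 hw')).isGaussNegligible
    (a := 1 / 2 * s ^ 2) (b := 2 * (1 / 2) * 0 * s + 0 * s) (Or.inl (by nlinarith)) 1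
  have h3 := h1.add_negligible h2
  simp only [zero_add, mul_zero, zero_mul, add_zero] at h3
  rw [one_div_mul_eq_div] at h3
  exact ⟨_, h3⟩

namespace SLcnParam

variable {p q n : ℕ}

lemma posSemidef_smul_dispersion (θ : SLcnParam p q) {c : ℝ} (hc : 0 ≤ c) :
    (c • θ.dispersion).PosSemidef := by
  -- Cholesky factorization.
  have h : θ.dispersion = !![θ.σ, 0; θ.ρ, √(1 - θ.ρ ^ 2)] * !![θ.σ, 0; θ.ρ, √(1 - θ.ρ ^ 2)]ᴴ := by
    have : √(1 - θ.ρ ^ 2) * √(1 - θ.ρ ^ 2) = 1 - θ.ρ ^ 2 :=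
      Real.mul_self_sqrt (by nlinarith [θ.neg_one_lt_ρ, θ.ρ_lt_one])
    ext i j
    fin_cases i <;> fin_cases j <;> simp [dispersion, Matrix.mul_apply, this] <;> ring
  rw [h]
  exact (Matrix.posSemidef_self_mul_conjTranspose _).smul hc

theorem selectionErrorCDF_eq (θ : SLcnParam p q) (z : ℝ) : θ.selectionErrorCDF z =
    θ.ν₁ * cdf (gaussianReal 0 (θ.ν₂⁻¹).toNNReal) z +
      (1 - θ.ν₁) * cdf (gaussianReal 0 1) z := by
  have key : ∀ c : ℝ, 0 ≤ c →
      (multivariateGaussian 0 (c • θ.dispersion)).real {ε : EuclideanSpace ℝ (Fin 2) | ε 1 ≤ z} =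
      cdf (gaussianReal 0 c.toNNReal) z := by
    intro c hc
    have h := measurePreserving_eval_multivariateGaussian (μ := 0)
      (θ.posSemidef_smul_dispersion hc) (i := 1)
    have := Measure.isProbabilityMeasure_map (μ := multivariateGaussian 0 (c • θ.dispersion))
      h.measurable.aemeasurable
    rw [show gaussianReal 0 c.toNNReal = gaussianReal ((0 : EuclideanSpace ℝ (Fin 2)) 1)
      ((c • θ.dispersion) 1 1).toNNReal by simp [dispersion], ← h.map_eq, cdf_eq_real,
      map_measureReal_apply h.measurable measurableSet_Iic]
    rfl
  have h1 := key _ (inv_nonneg.2 θ.ν₂_pos.le)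
  have h2 := key 1 zero_le_one
  rw [one_smul, Real.toNNReal_one] at h2
  rw [← h1, ← h2, selectionErrorCDF, errorLaw, contaminatedNormal]
  simp only [Measure.real, Measure.add_apply, Measure.smul_apply, smul_eq_mul]
  rw [ENNReal.toReal_add (ENNReal.mul_ne_top ENNReal.ofReal_ne_top (measure_ne_top _ _))
    (ENNReal.mul_ne_top ENNReal.ofReal_ne_top (measure_ne_top _ _)), ENNReal.toReal_mul,
    ENNReal.toReal_mul, ENNReal.toReal_ofReal θ.ν₁_pos.le,
    ENNReal.toReal_ofReal (sub_pos.2 θ.ν₁_lt_one).le]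

lemma selectionErrorCDF_eq_stdNormalCDF (θ : SLcnParam p q) (z : ℝ) : θ.selectionErrorCDF z =
    θ.ν₁ * stdNormalCDF (√θ.ν₂ * z) + (1 - θ.ν₁) * stdNormalCDF z := by
  have := θ.ν₂_pos
  rw [selectionErrorCDF_eq, cdf_gaussianReal_zero (Real.sqrt_pos.2 θ.ν₂_pos)]
  · rfl
  · rw [inv_pow, Real.sq_sqrt this.le, Real.coe_toNNReal _ (by positivity)]

theorem tailConditions_selectionErrorCDF (θ : SLcnParam p q) :
    TailCondition1 θ.selectionErrorCDF ∧ TailCondition2 θ.selectionErrorCDF ∧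
      TailCondition3 θ.selectionErrorCDF := by
  have hs : 0 < √θ.ν₂ := Real.sqrt_pos.2 θ.ν₂_pos
  obtain ⟨C, hC⟩ := hasGaussTail_stdNormalCDF_mixture θ.ν₁_pos θ.ν₁_lt_one hs
    ((Real.sqrt_lt' one_pos).2 (by simpa using θ.ν₂_lt_one))
  have hneg : HasGaussTail (fun z => θ.selectionErrorCDF (-z)) (√θ.ν₂ ^ 2 / 2) 0 1 C := by
    simpa only [selectionErrorCDF_eq_stdNormalCDF, mul_neg] using hC
  have hsub : HasGaussTail (fun z => 1 - θ.selectionErrorCDF z) (√θ.ν₂ ^ 2 / 2) 0 1 C := by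
    convert hneg using 2 with z
    rw [selectionErrorCDF_eq_stdNormalCDF, selectionErrorCDF_eq_stdNormalCDF, mul_neg,
      stdNormalCDF_neg, stdNormalCDF_neg]
    ring
  have ha : 0 < √θ.ν₂ ^ 2 / 2 := by positivity
  exact ⟨tailCondition1_of_hasGaussTail ha hneg, tailCondition2_of_hasGaussTail ha hsub,
    tailCondition3_of_hasGaussTail ha hsub⟩

end SLcnParam

/-! ### The density of the observed outcome -/

/-- The covariance is `L Lᵀ` with `L` lower triangular with rows `(a, 0)` and `(b, c)`, and the
characteristic functions agree. The triangular form makes the outcome depend on one normal variable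
only, so that the other can be integrated out. -/
lemma multivariateGaussian_fin_two_eq_map (a b c : ℝ) :
    multivariateGaussian 0 !![a ^ 2, a * b; a * b, b ^ 2 + c ^ 2] =
      ((gaussianReal 0 1).prod (gaussianReal 0 1)).map
        fun z => (!₂[a * z.1, b * z.1 + c * z.2] : EuclideanSpace ℝ (Fin 2)) := by
  have hS : (!![a ^ 2, a * b; a * b, b ^ 2 + c ^ 2] : Matrix (Fin 2) (Fin 2) ℝ).PosSemidef := by
    have h : (!![a ^ 2, a * b; a * b, b ^ 2 + c ^ 2] : Matrix (Fin 2) (Fin 2) ℝ) =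
        !![a, 0; b, c] * !![a, 0; b, c]ᴴ := by
      ext i j
      fin_cases i <;> fin_cases j <;> simp [Matrix.mul_apply] <;> ring
    rw [h]
    exact Matrix.posSemidef_self_mul_conjTranspose _
  have hmeas : Measurable fun z : ℝ × ℝ =>
      (!₂[a * z.1, b * z.1 + c * z.2] : EuclideanSpace ℝ (Fin 2)) := by
    apply (WithLp.measurable_toLp 2 (Fin 2 → ℝ)).comp
    refine measurable_pi_iff.2 fun i => ?_
    fin_cases i <;> simp <;> fun_prop
  have := Measure.isProbabilityMeasure_map
    (μ := (gaussianReal 0 1).prod (gaussianReal 0 1)) hmeas.aemeasurable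
  apply Measure.ext_of_charFun
  ext t
  rw [charFun_multivariateGaussian hS, charFun_apply, integral_map hmeas.aemeasurable
    (Measurable.aestronglyMeasurable (by fun_prop))]
  have hsplit : ∀ z : ℝ × ℝ, Complex.exp
      (((inner ℝ (!₂[a * z.1, b * z.1 + c * z.2] : EuclideanSpace ℝ (Fin 2)) t : ℝ) : ℂ) *
        Complex.I) = Complex.exp (((a * t 0 + b * t 1 : ℝ) : ℂ) * z.1 * Complex.I) *
        Complex.exp (((c * t 1 : ℝ) : ℂ) * z.2 * Complex.I) := by
    intro z
    rw [← Complex.exp_add]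
    congr 1
    simp [PiLp.inner_apply, Fin.sum_univ_two]
    ring
  simp_rw [hsplit]
  rw [integral_prod_mul (fun z : ℝ => Complex.exp (((a * t 0 + b * t 1 : ℝ) : ℂ) * z * Complex.I))
    fun z : ℝ => Complex.exp (((c * t 1 : ℝ) : ℂ) * z * Complex.I),
    ← charFun_apply_real, ← charFun_apply_real, charFun_gaussianReal, charFun_gaussianReal,
    ← Complex.exp_add]
  congr 1
  simp [dotProduct, Matrix.mulVec, Fin.sum_univ_two]
  ring

lemma gaussianReal_zero_one_Ioi_neg (x : ℝ) :
    gaussianReal 0 1 (Set.Ioi (-x)) = ENNReal.ofReal (stdNormalCDF x) := by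
  rw [← Set.compl_Iic, prob_compl_eq_one_sub measurableSet_Iic, ← ofReal_cdf]
  change 1 - ENNReal.ofReal (stdNormalCDF (-x)) = _
  rw [← ENNReal.ofReal_one, ← ENNReal.ofReal_sub _ (stdNormalCDF_pos _).le, stdNormalCDF_neg]
  congr 1
  ring

/-- The density `k φ(k (y - μ)) Φ(A + B k (y - μ))` of a scaled normal variable, restricted to the
event of being selected. -/
noncomputable def selectedNormalDensity (k μ A B y : ℝ) : ℝ :=
  k * stdNormalPDF (k * (y - μ)) * stdNormalCDF (A + B * (k * (y - μ)))

lemma continuous_selectedNormalDensity (k μ A B : ℝ) :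
    Continuous (selectedNormalDensity k μ A B) := by
  unfold selectedNormalDensity
  have := continuous_stdNormalPDF
  have := continuous_stdNormalCDF
  fun_prop

lemma selectedNormalDensity_pos {k : ℝ} (hk : 0 < k) (μ A B y : ℝ) :
    0 < selectedNormalDensity k μ A B y :=
  mul_pos (mul_pos hk (stdNormalPDF_pos _)) (stdNormalCDF_pos _)

lemma gaussianPDFReal_eq_stdNormalPDF {k : ℝ} (hk : 0 < k) (μ y : ℝ) (v : NNReal)
    (hv : (v : ℝ) = k⁻¹ ^ 2) : gaussianPDFReal μ v y = k * stdNormalPDF (k * (y - μ)) := by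
  rw [gaussianPDFReal, stdNormalPDF, hv, Real.sqrt_mul' _ (by positivity),
    Real.sqrt_sq (by positivity)]
  rw [show -(y - μ) ^ 2 / (2 * k⁻¹ ^ 2) = -((k * (y - μ)) ^ 2 / 2) by field_simp]
  field_simp

/-- The law of `(Y₁, Y₂) = (μ + Z₁ / k, m + (ρ Z₁ + r Z₂) / s)` on `{Y₂ > 0}` has a density. -/
lemma prod_gaussianReal_selected {k s r : ℝ} (hk : 0 < k) (hs : 0 < s) (hr : 0 < r) (μ m ρ : ℝ)
    {D : Set ℝ} (hD : MeasurableSet D) :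
    ((gaussianReal 0 1).prod (gaussianReal 0 1))
      {z | 0 < m + s⁻¹ * (ρ * z.1 + r * z.2) ∧ μ + k⁻¹ * z.1 ∈ D} =
    ∫⁻ y in D, ENNReal.ofReal (selectedNormalDensity k μ (s * m / r) (ρ / r) y) := by
  have hms : MeasurableSet {z : ℝ × ℝ | 0 < m + s⁻¹ * (ρ * z.1 + r * z.2) ∧ μ + k⁻¹ * z.1 ∈ D} := by
    have h1 : Measurable fun z : ℝ × ℝ => m + s⁻¹ * (ρ * z.1 + r * z.2) := by fun_prop
    have h2 : Measurable fun z : ℝ × ℝ => μ + k⁻¹ * z.1 := by fun_prop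
    exact (h1 measurableSet_Ioi).inter (h2 hD)
  have hmc : Measurable stdNormalCDF := continuous_stdNormalCDF.measurable
  set v : NNReal := (k⁻¹ ^ 2).toNNReal with hv_def
  have hv : (v : ℝ) = k⁻¹ ^ 2 := Real.coe_toNNReal _ (by positivity)
  have hv0 : v ≠ 0 := by
    intro h
    rw [h] at hv
    have : 0 < k⁻¹ ^ 2 := by positivity
    simp [← hv] at this
  let G : ℝ → ENNReal := D.indicator fun y =>
    ENNReal.ofReal (stdNormalCDF (s * m / r + ρ / r * (k * (y - μ))))
  have hG : Measurable G := Measurable.indicator (by fun_prop) hD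
  rw [Measure.prod_apply hms]
  -- For a fixed first coordinate, selection is a half-line condition on the second, whose Gaussian
  -- mass is the factor `Φ` of the density.
  have hsec : ∀ z : ℝ, gaussianReal 0 1 (Prod.mk z ⁻¹'
      {z : ℝ × ℝ | 0 < m + s⁻¹ * (ρ * z.1 + r * z.2) ∧ μ + k⁻¹ * z.1 ∈ D}) = G (μ + k⁻¹ * z) := by
    intro z
    by_cases hz : μ + k⁻¹ * z ∈ D
    · simp only [G, Set.indicator_of_mem hz]
      rw [← gaussianReal_zero_one_Ioi_neg]
      congr 1
      ext t
      simp only [Set.mem_preimage, Set.mem_ofPred_eq, hz, and_true, Set.mem_Ioi]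
      have h1 : m + s⁻¹ * (ρ * z + r * t) =
          s⁻¹ * r * (t - -(s * m / r + ρ / r * (k * (μ + k⁻¹ * z - μ)))) := by
        field_simp
        ring
      rw [h1, mul_pos_iff_of_pos_left (by positivity), sub_pos]
    · simp [G, hz]
  simp_rw [hsec]
  rw [← lintegral_map hG (by fun_prop), ← gaussianReal_eq_map_affine μ k⁻¹ v hv,
    gaussianReal_of_var_ne_zero _ hv0, lintegral_withDensity_eq_lintegral_mul _
      (measurable_gaussianPDF _ _) hG, ← lintegral_indicator hD]
  congr 1
  ext y
  by_cases hy : y ∈ D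
  · simp only [G, Pi.mul_apply, Set.indicator_of_mem hy, gaussianPDF, selectedNormalDensity]
    rw [gaussianPDFReal_eq_stdNormalPDF hk μ y v hv, ← ENNReal.ofReal_mul]
    exact (mul_pos hk (stdNormalPDF_pos _)).le
  · simp [G, hy]

lemma eq_of_measure_pi_eq {ι : Type*} [Fintype ι] {α : ι → Type*} [∀ i, MeasurableSpace (α i)]
    {μ ν : ∀ i, Measure (α i)} [∀ i, IsProbabilityMeasure (μ i)] [∀ i, IsProbabilityMeasure (ν i)]
    (h : Measure.pi μ = Measure.pi ν) : μ = ν := by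
  classical
  funext i
  have h1 := congrArg (Measure.map (Function.eval i)) h
  rw [Measure.pi_map_eval, Measure.pi_map_eval] at h1
  simpa using h1

lemma measurable_observe : Measurable observe := by
  unfold observe
  refine Measurable.ite (measurableSet_lt measurable_const (by fun_prop)) ?_ measurable_const
  exact measurable_inl.comp (by fun_prop)

namespace SLcnParam

variable {p q n : ℕ}

lemma measurable_response (θ : SLcnParam p q) (x : Fin p → ℝ) (w : Fin q → ℝ) :
    Measurable (θ.response x w) := by
  unfold response
  apply (WithLp.measurable_toLp 2 (Fin 2 → ℝ)).comp
  refine measurable_pi_iff.2 fun i => ?_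
  fin_cases i <;> simp <;> fun_prop

lemma measurable_observe_response (θ : SLcnParam p q) (x : Fin p → ℝ) (w : Fin q → ℝ) :
    Measurable fun ε => observe (θ.response x w ε) :=
  measurable_observe.comp (θ.measurable_response x w)

instance (θ : SLcnParam p q) : IsProbabilityMeasure θ.errorLaw := by
  constructor
  rw [errorLaw, contaminatedNormal]
  simp only [Measure.add_apply, Measure.smul_apply, smul_eq_mul, measure_univ, mul_one]
  rw [← ENNReal.ofReal_add θ.ν₁_pos.le (sub_pos.2 θ.ν₁_lt_one).le]
  simp

instance isProbabilityMeasure_unitLaw (θ : SLcnParam p q) (x : Fin p → ℝ) (w : Fin q → ℝ) :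
    IsProbabilityMeasure (θ.unitLaw x w) :=
  Measure.isProbabilityMeasure_map (θ.measurable_observe_response x w).aemeasurable

/-- The residual scale `√(1 - ρ²)` of the selection error given the outcome error. -/
noncomputable def residualScale (θ : SLcnParam p q) : ℝ := √(1 - θ.ρ ^ 2)

lemma residualScale_sq (θ : SLcnParam p q) : θ.residualScale ^ 2 = 1 - θ.ρ ^ 2 :=
  Real.sq_sqrt (by nlinarith [θ.neg_one_lt_ρ, θ.ρ_lt_one])

lemma residualScale_pos (θ : SLcnParam p q) : 0 < θ.residualScale :=
  Real.sqrt_pos.2 (by nlinarith [θ.neg_one_lt_ρ, θ.ρ_lt_one])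

lemma multivariateGaussian_observed (θ : SLcnParam p q) (x : Fin p → ℝ) (w : Fin q → ℝ) {s : ℝ}
    (hs : 0 < s) {D : Set ℝ} (hD : MeasurableSet D) :
    (multivariateGaussian 0 (s⁻¹ ^ 2 • θ.dispersion)).map
      (fun ε => observe (θ.response x w ε)) (Sum.inl '' D) =
    ∫⁻ y in D, ENNReal.ofReal (selectedNormalDensity (s / θ.σ) (x ⬝ᵥ θ.β)
      (s * (w ⬝ᵥ θ.γ) / θ.residualScale) (θ.ρ / θ.residualScale) y) := by
  have hσ := θ.σ_pos
  have hS : s⁻¹ ^ 2 • θ.dispersion = !![(s⁻¹ * θ.σ) ^ 2, (s⁻¹ * θ.σ) * (s⁻¹ * θ.ρ);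
      (s⁻¹ * θ.σ) * (s⁻¹ * θ.ρ), (s⁻¹ * θ.ρ) ^ 2 + (s⁻¹ * θ.residualScale) ^ 2] := by
    ext i j
    fin_cases i <;> fin_cases j <;> simp [dispersion, mul_pow, residualScale_sq] <;> ring
  have hmeas : Measurable fun z : ℝ × ℝ => (!₂[s⁻¹ * θ.σ * z.1,
      s⁻¹ * θ.ρ * z.1 + s⁻¹ * θ.residualScale * z.2] : EuclideanSpace ℝ (Fin 2)) := by
    apply (WithLp.measurable_toLp 2 (Fin 2 → ℝ)).comp
    refine measurable_pi_iff.2 fun i => ?_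
    fin_cases i <;> simp <;> fun_prop
  rw [hS, multivariateGaussian_fin_two_eq_map,
    Measure.map_map (θ.measurable_observe_response x w) hmeas,
    Measure.map_apply ((θ.measurable_observe_response x w).comp hmeas)
      (MeasurableSet.inl_image hD),
    ← prod_gaussianReal_selected (div_pos hs hσ) hs θ.residualScale_pos _ _ _ hD]
  congr 1
  ext z
  have h1 : s⁻¹ * θ.ρ * z.1 + s⁻¹ * θ.residualScale * z.2 =
      s⁻¹ * (θ.ρ * z.1 + θ.residualScale * z.2) := by ring
  have h2 : s⁻¹ * θ.σ * z.1 = (s / θ.σ)⁻¹ * z.1 := by rw [inv_div]; ring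
  simp only [Set.mem_preimage, Function.comp_apply, observe, response, Set.mem_ofPred_eq]
  simp only [Matrix.cons_val_zero, Matrix.cons_val_one]
  rw [h1, h2]
  split_ifs with h <;> simp [h]

/-- The density of the outcome on the event that it is observed, for a unit with outcome location
`μ` and selection location `m`. -/
noncomputable def outcomeDensity (θ : SLcnParam p q) (μ m y : ℝ) : ℝ :=
  θ.ν₁ * selectedNormalDensity (√θ.ν₂ / θ.σ) μ (√θ.ν₂ * m / θ.residualScale)
      (θ.ρ / θ.residualScale) y +
    (1 - θ.ν₁) * selectedNormalDensity (1 / θ.σ) μ (m / θ.residualScale)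
      (θ.ρ / θ.residualScale) y

lemma continuous_outcomeDensity (θ : SLcnParam p q) (μ m : ℝ) :
    Continuous (θ.outcomeDensity μ m) := by
  unfold outcomeDensity
  have h1 := continuous_selectedNormalDensity (√θ.ν₂ / θ.σ) μ (√θ.ν₂ * m / θ.residualScale)
    (θ.ρ / θ.residualScale)
  have h2 := continuous_selectedNormalDensity (1 / θ.σ) μ (m / θ.residualScale)
    (θ.ρ / θ.residualScale)
  fun_prop

lemma outcomeDensity_pos (θ : SLcnParam p q) (μ m y : ℝ) : 0 < θ.outcomeDensity μ m y := by
  have h1 := θ.ν₁_pos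
  have h2 := sub_pos.2 θ.ν₁_lt_one
  have h3 := selectedNormalDensity_pos (div_pos (Real.sqrt_pos.2 θ.ν₂_pos) θ.σ_pos) μ
    (√θ.ν₂ * m / θ.residualScale) (θ.ρ / θ.residualScale) y
  have h4 := selectedNormalDensity_pos (one_div_pos.2 θ.σ_pos) μ (m / θ.residualScale)
    (θ.ρ / θ.residualScale) y
  unfold outcomeDensity
  positivity

theorem unitLaw_inl_image (θ : SLcnParam p q) (x : Fin p → ℝ) (w : Fin q → ℝ) {D : Set ℝ}
    (hD : MeasurableSet D) : θ.unitLaw x w (Sum.inl '' D) =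
      ∫⁻ y in D, ENNReal.ofReal (θ.outcomeDensity (x ⬝ᵥ θ.β) (w ⬝ᵥ θ.γ) y) := by
  have hs := Real.sqrt_pos.2 θ.ν₂_pos
  have h1 := θ.multivariateGaussian_observed x w hs hD
  have h2 := θ.multivariateGaussian_observed x w one_pos hD
  rw [inv_pow, Real.sq_sqrt θ.ν₂_pos.le] at h1
  rw [inv_one, one_pow, one_smul, one_mul] at h2
  rw [unitLaw, errorLaw, contaminatedNormal, Measure.map_add _ _
    (θ.measurable_observe_response x w), Measure.map_smul, Measure.map_smul]
  simp only [Measure.add_apply, Measure.smul_apply, smul_eq_mul]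
  have hm : ∀ k μ A B, Measurable fun y => ENNReal.ofReal (selectedNormalDensity k μ A B y) :=
    fun k μ A B => (continuous_selectedNormalDensity k μ A B).measurable.ennreal_ofReal
  rw [h1, h2, ← lintegral_const_mul _ (hm _ _ _ _), ← lintegral_const_mul _ (hm _ _ _ _),
    ← lintegral_add_left ((hm _ _ _ _).const_mul _)]
  congr 1
  ext y
  have hν₁ := θ.ν₁_pos
  have hν₁' := sub_pos.2 θ.ν₁_lt_one
  rw [← ENNReal.ofReal_mul hν₁.le, ← ENNReal.ofReal_mul hν₁'.le, ← ENNReal.ofReal_add]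
  · rfl
  · exact (mul_pos hν₁ (selectedNormalDensity_pos (div_pos hs θ.σ_pos) _ _ _ _)).le
  · exact (mul_pos hν₁' (selectedNormalDensity_pos (one_div_pos.2 θ.σ_pos) _ _ _ _)).le

/-- Equal laws give densities equal almost everywhere, and continuity upgrades this to equality at
every point. The mass of the unselected event is not needed. -/
theorem outcomeDensity_eq_of_unitLaw_eq {θ θ' : SLcnParam p q} {x : Fin p → ℝ} {w : Fin q → ℝ}
    (h : θ.unitLaw x w = θ'.unitLaw x w) :
    θ.outcomeDensity (x ⬝ᵥ θ.β) (w ⬝ᵥ θ.γ) = θ'.outcomeDensity (x ⬝ᵥ θ'.β) (w ⬝ᵥ θ'.γ) := by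
  have hc := θ.continuous_outcomeDensity (x ⬝ᵥ θ.β) (w ⬝ᵥ θ.γ)
  have hc' := θ'.continuous_outcomeDensity (x ⬝ᵥ θ'.β) (w ⬝ᵥ θ'.γ)
  have hd : volume.withDensity (fun y => ENNReal.ofReal
      (θ.outcomeDensity (x ⬝ᵥ θ.β) (w ⬝ᵥ θ.γ) y)) = volume.withDensity fun y => ENNReal.ofReal
      (θ'.outcomeDensity (x ⬝ᵥ θ'.β) (w ⬝ᵥ θ'.γ) y) := by
    ext D hD
    rw [withDensity_apply _ hD, withDensity_apply _ hD, ← unitLaw_inl_image θ x w hD,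
      ← unitLaw_inl_image θ' x w hD, h]
  rw [withDensity_eq_iff_of_sigmaFinite hc.measurable.ennreal_ofReal.aemeasurable
    hc'.measurable.ennreal_ofReal.aemeasurable] at hd
  refine (hc.ae_eq_iff_eq (μ := volume) hc').1 ?_
  filter_upwards [hd] with y hy
  exact (ENNReal.ofReal_eq_ofReal_iff (θ.outcomeDensity_pos _ _ y).le
    (θ'.outcomeDensity_pos _ _ y).le).1 hy

theorem unitLaw_eq_of_sampleLaw_eq {X : Matrix (Fin n) (Fin p) ℝ} {W : Matrix (Fin n) (Fin q) ℝ}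
    {θ θ' : SLcnParam p q} (h : sampleLaw X W θ = sampleLaw X W θ') (i : Fin n) :
    θ.unitLaw (X i) (W i) = θ'.unitLaw (X i) (W i) := by
  have h₁ : ∀ i, IsProbabilityMeasure (θ.unitLaw (X i) (W i)) := fun i =>
    θ.isProbabilityMeasure_unitLaw _ _
  have h₂ : ∀ i, IsProbabilityMeasure (θ'.unitLaw (X i) (W i)) := fun i =>
    θ'.isProbabilityMeasure_unitLaw _ _
  exact congrFun (eq_of_measure_pi_eq (μ := fun i => θ.unitLaw (X i) (W i))
    (ν := fun i => θ'.unitLaw (X i) (W i)) h) i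

end SLcnParam

/-! ### Tails of the outcome density -/

lemma hasGaussTail_stdNormalPDF_affine {k : ℝ} (hk : 0 < k) (μ : ℝ) :
    HasGaussTail (fun y => k * stdNormalPDF (k * (y - μ))) (k ^ 2 / 2) (-(k ^ 2 * μ)) 0
      (k * stdNormalPDF (k * μ)) := by
  have h := (hasGaussTail_stdNormalPDF.comp_affine (-(k * μ)) hk).const_mul hk
  convert h using 1
  · ext y
    congr 2
    ring
  · ring
  · ring
  · rw [stdNormalPDF, pow_zero, div_one]
    congr 4
    ring

lemma hasGaussTail_selectedNormalDensity {k μ A B L : ℝ} (hk : 0 < k) (hL : 0 < L)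
    (h : Tendsto (fun y => stdNormalCDF (A + B * (k * (y - μ)))) atTop (𝓝 L)) :
    HasGaussTail (selectedNormalDensity k μ A B) (k ^ 2 / 2) (-(k ^ 2 * μ)) 0
      (k * stdNormalPDF (k * μ) * L) := by
  have h1 := (hasGaussTail_stdNormalPDF_affine hk μ).mul (HasGaussTail.of_tendsto hL h)
  simp only [add_zero] at h1
  exact h1

lemma hasGaussTail_selectedNormalDensity_of_pos {k B : ℝ} (hk : 0 < k) (hB : 0 < B) (μ A : ℝ) :
    HasGaussTail (selectedNormalDensity k μ A B) (k ^ 2 / 2) (-(k ^ 2 * μ)) 0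
      (k * stdNormalPDF (k * μ) * 1) := by
  refine hasGaussTail_selectedNormalDensity hk one_pos ((tendsto_cdf_atTop _).comp ?_)
  exact tendsto_atTop_add_const_left _ _ (((tendsto_atTop_add_const_right _ _
    tendsto_id).const_mul_atTop hk).const_mul_atTop hB)

lemma hasGaussTail_selectedNormalDensity_zero {k : ℝ} (hk : 0 < k) (μ A : ℝ) :
    HasGaussTail (selectedNormalDensity k μ A 0) (k ^ 2 / 2) (-(k ^ 2 * μ)) 0
      (k * stdNormalPDF (k * μ) * stdNormalCDF A) :=
  hasGaussTail_selectedNormalDensity hk (stdNormalCDF_pos _) (by simp)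

/-- The argument of `Φ` now tends to `-∞`, so Mills' ratio contributes a second Gaussian factor and
the power `1 / y`. -/
lemma hasGaussTail_selectedNormalDensity_of_neg {k B : ℝ} (hk : 0 < k) (hB : B < 0) (μ A : ℝ) :
    ∃ C, HasGaussTail (selectedNormalDensity k μ A B) (k ^ 2 * (1 + B ^ 2) / 2)
      (-(k ^ 2 * (1 + B ^ 2) * μ) + A * B * k) 1 C := by
  have h1 := hasGaussTail_stdNormalCDF_neg.comp_affine (-A + B * k * μ) (β := -B * k)
    (mul_pos (neg_pos.2 hB) hk)
  have h2 := (hasGaussTail_stdNormalPDF_affine hk μ).mul h1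
  have hfun : selectedNormalDensity k μ A B = fun y =>
      k * stdNormalPDF (k * (y - μ)) * stdNormalCDF (-(-A + B * k * μ + -B * k * y)) := by
    ext y
    rw [selectedNormalDensity]
    congr 2
    ring
  rw [hfun, show k ^ 2 * (1 + B ^ 2) / 2 = k ^ 2 / 2 + 1 / 2 * (-B * k) ^ 2 by ring,
    show -(k ^ 2 * (1 + B ^ 2) * μ) + A * B * k =
      -(k ^ 2 * μ) + (2 * (1 / 2) * (-A + B * k * μ) * (-B * k) + 0 * (-B * k)) by ring]
  exact ⟨_, h2⟩

/-- If `m < m'`, both values of `Φ` increase, so both weights `w` and `1 - w` would have to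
decrease, although they sum to `1`. -/
lemma mixing_le_of_selected_mass_eq {s w w' m m' : ℝ} (hs : 0 < s) (hw : 0 < w) (hw' : w < 1)
    (h₁ : w * stdNormalCDF (s * m) = w' * stdNormalCDF (s * m'))
    (h₂ : (1 - w) * stdNormalCDF m = (1 - w') * stdNormalCDF m') : m' ≤ m := by
  by_contra! hlt
  have h3 := strictMono_stdNormalCDF hlt
  have h4 := strictMono_stdNormalCDF (mul_lt_mul_of_pos_left hlt hs)
  have h5 : w' < w := lt_of_mul_lt_mul_right
    (h₁ ▸ mul_lt_mul_of_pos_left h4 hw) (stdNormalCDF_pos _).le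
  have h6 : 1 - w' < 1 - w := lt_of_mul_lt_mul_right
    (h₂ ▸ mul_lt_mul_of_pos_left h3 (sub_pos.2 hw')) (stdNormalCDF_pos _).le
  linarith

lemma mixing_eq {s w w' m m' : ℝ} (hs : 0 < s) (hw : 0 < w) (hw₁ : w < 1) (hw' : 0 < w')
    (hw₁' : w' < 1) (h₁ : w * stdNormalCDF (s * m) = w' * stdNormalCDF (s * m'))
    (h₂ : (1 - w) * stdNormalCDF m = (1 - w') * stdNormalCDF m') : m = m' ∧ w = w' := by
  obtain rfl : m = m' := le_antisymm
    (mixing_le_of_selected_mass_eq hs hw' hw₁' h₁.symm h₂.symm)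
    (mixing_le_of_selected_mass_eq hs hw hw₁ h₁ h₂)
  exact ⟨rfl, mul_right_cancel₀ (stdNormalCDF_pos _).ne' h₁⟩

namespace SLcnParam

variable {p q : ℕ}

/-- The contaminated component is the wider one, so it dominates the tails of the outcome density.
-/
lemma selectedNormalDensity_components_order (θ : SLcnParam p q) :
    0 < √θ.ν₂ / θ.σ ∧ (√θ.ν₂ / θ.σ) ^ 2 < (1 / θ.σ) ^ 2 := by
  have hσ := θ.σ_pos
  have h0 : 0 < √θ.ν₂ := Real.sqrt_pos.2 θ.ν₂_pos
  have h1 : √θ.ν₂ < 1 := (Real.sqrt_lt' one_pos).2 (by simpa using θ.ν₂_lt_one)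
  exact ⟨by positivity, by gcongr⟩

lemma hasGaussTail_outcomeDensity_of_pos (θ : SLcnParam p q) (hρ : 0 < θ.ρ) (μ m : ℝ) :
    HasGaussTail (θ.outcomeDensity μ m) ((√θ.ν₂ / θ.σ) ^ 2 / 2) (-((√θ.ν₂ / θ.σ) ^ 2 * μ)) 0
      (θ.ν₁ * (√θ.ν₂ / θ.σ * stdNormalPDF (√θ.ν₂ / θ.σ * μ) * 1)) := by
  obtain ⟨hk, hlt⟩ := θ.selectedNormalDensity_components_order
  have hB := div_pos hρ θ.residualScale_pos
  exact ((hasGaussTail_selectedNormalDensity_of_pos hk hB μ _).const_mul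
    θ.ν₁_pos).add_negligible (((hasGaussTail_selectedNormalDensity_of_pos (one_div_pos.2 θ.σ_pos)
      hB μ _).const_mul (sub_pos.2 θ.ν₁_lt_one)).isGaussNegligible (Or.inl (by linarith)) 0)

lemma hasGaussTail_outcomeDensity_of_eq_zero (θ : SLcnParam p q) (hρ : θ.ρ = 0) (μ m : ℝ) :
    HasGaussTail (θ.outcomeDensity μ m) ((√θ.ν₂ / θ.σ) ^ 2 / 2) (-((√θ.ν₂ / θ.σ) ^ 2 * μ)) 0
      (θ.ν₁ * (√θ.ν₂ / θ.σ * stdNormalPDF (√θ.ν₂ / θ.σ * μ) *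
        stdNormalCDF (√θ.ν₂ * m / θ.residualScale))) := by
  obtain ⟨hk, hlt⟩ := θ.selectedNormalDensity_components_order
  unfold outcomeDensity
  rw [hρ, zero_div]
  exact ((hasGaussTail_selectedNormalDensity_zero hk μ _).const_mul
    θ.ν₁_pos).add_negligible (((hasGaussTail_selectedNormalDensity_zero (one_div_pos.2 θ.σ_pos)
      μ _).const_mul (sub_pos.2 θ.ν₁_lt_one)).isGaussNegligible (Or.inl (by linarith)) 0)

lemma hasGaussTail_outcomeDensity_of_neg (θ : SLcnParam p q) (hρ : θ.ρ < 0) (μ m : ℝ) :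
    ∃ C, HasGaussTail (θ.outcomeDensity μ m)
      ((√θ.ν₂ / θ.σ) ^ 2 * (1 + (θ.ρ / θ.residualScale) ^ 2) / 2)
      (-((√θ.ν₂ / θ.σ) ^ 2 * (1 + (θ.ρ / θ.residualScale) ^ 2) * μ) +
        √θ.ν₂ * m / θ.residualScale * (θ.ρ / θ.residualScale) * (√θ.ν₂ / θ.σ)) 1 C := by
  obtain ⟨hk, hlt⟩ := θ.selectedNormalDensity_components_order
  have hB := div_neg_of_neg_of_pos hρ θ.residualScale_pos
  obtain ⟨C₁, h₁⟩ := hasGaussTail_selectedNormalDensity_of_neg hk hB μ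
    (√θ.ν₂ * m / θ.residualScale)
  obtain ⟨C₂, h₂⟩ := hasGaussTail_selectedNormalDensity_of_neg (one_div_pos.2 θ.σ_pos) hB μ
    (m / θ.residualScale)
  have hpos : 0 < 1 + (θ.ρ / θ.residualScale) ^ 2 := by positivity
  exact ⟨_, (h₁.const_mul θ.ν₁_pos).add_negligible ((h₂.const_mul
    (sub_pos.2 θ.ν₁_lt_one)).isGaussNegligible (Or.inl (by gcongr)) 1)⟩

/-! ### Reflection and the sign of the correlation -/

/-- The parameter with the outcome error reflected. -/
def reflect (θ : SLcnParam p q) : SLcnParam p q where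
  __ := θ
  ρ := -θ.ρ
  neg_one_lt_ρ := neg_lt_neg θ.ρ_lt_one
  ρ_lt_one := by linarith [θ.neg_one_lt_ρ]

lemma residualScale_reflect (θ : SLcnParam p q) : θ.reflect.residualScale = θ.residualScale := by
  simp [residualScale, reflect]

/-- This turns statements about the tail at `-∞` into statements about the tail at `+∞`. -/
lemma outcomeDensity_reflect (θ : SLcnParam p q) (μ m : ℝ) :
    θ.reflect.outcomeDensity (-μ) m = fun y => θ.outcomeDensity μ m (-y) := by
  ext y
  have h : ∀ k A B, selectedNormalDensity k (-μ) A (-B) y = selectedNormalDensity k μ A B (-y) := by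
    intro k A B
    have h1 : k * (y - -μ) = -(k * (-y - μ)) := by ring
    rw [selectedNormalDensity, selectedNormalDensity, h1, neg_mul_neg]
    simp [stdNormalPDF]
  rw [outcomeDensity, outcomeDensity, residualScale_reflect, ← h, ← h, ← neg_div]
  rfl

lemma reflect_outcomeDensity_eq {θ θ' : SLcnParam p q} {μ m μ' m' : ℝ}
    (h : θ.outcomeDensity μ m = θ'.outcomeDensity μ' m') :
    θ.reflect.outcomeDensity (-μ) m = θ'.reflect.outcomeDensity (-μ') m' := by
  rw [outcomeDensity_reflect, outcomeDensity_reflect, h]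

lemma exists_hasGaussTail_of_nonneg (θ : SLcnParam p q) (hρ : 0 ≤ θ.ρ) (μ m : ℝ) :
    ∃ a b C, HasGaussTail (θ.outcomeDensity μ m) a b 0 C := by
  rcases hρ.lt_or_eq with h | h
  · exact ⟨_, _, _, θ.hasGaussTail_outcomeDensity_of_pos h μ m⟩
  · exact ⟨_, _, _, θ.hasGaussTail_outcomeDensity_of_eq_zero h.symm μ m⟩

/-- The exponent `e` of the right tail is `1` for negative correlation and `0` otherwise. -/
lemma rho_neg_of_outcomeDensity_eq {θ θ' : SLcnParam p q} {μ m μ' m' : ℝ}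
    (h : θ.outcomeDensity μ m = θ'.outcomeDensity μ' m') (hρ : θ.ρ < 0) : θ'.ρ < 0 := by
  by_contra! hρ'
  obtain ⟨C, h1⟩ := θ.hasGaussTail_outcomeDensity_of_neg hρ μ m
  obtain ⟨a, b, C', h2⟩ := θ'.exists_hasGaussTail_of_nonneg hρ' μ' m'
  rw [h] at h1
  exact one_ne_zero (h1.unique h2).2.2.1

lemma rho_pos_of_outcomeDensity_eq {θ θ' : SLcnParam p q} {μ m μ' m' : ℝ}
    (h : θ.outcomeDensity μ m = θ'.outcomeDensity μ' m') (hρ : 0 < θ.ρ) : 0 < θ'.ρ :=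
  neg_lt_zero.1 (rho_neg_of_outcomeDensity_eq (reflect_outcomeDensity_eq h) (neg_lt_zero.2 hρ))

/-! ### Recovery of the parameters from the density -/

lemma location_eq_of_quadratic_eq {k k' μ μ' : ℝ} (hk : 0 < k) (hk' : 0 < k')
    (ha : k ^ 2 / 2 = k' ^ 2 / 2) (hb : -(k ^ 2 * μ) = -(k' ^ 2 * μ')) : k = k' ∧ μ = μ' := by
  have h1 : k ^ 2 = k' ^ 2 := by linarith
  obtain rfl : k = k' := (pow_left_inj₀ hk.le hk'.le two_ne_zero).1 h1
  exact ⟨rfl, mul_left_cancel₀ (pow_pos hk 2).ne' (neg_injective hb)⟩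

lemma scales_eq {θ θ' : SLcnParam p q} (h₁ : √θ.ν₂ / θ.σ = √θ'.ν₂ / θ'.σ)
    (h₂ : 1 / θ.σ = 1 / θ'.σ) : θ.σ = θ'.σ ∧ √θ.ν₂ = √θ'.ν₂ ∧ θ.ν₂ = θ'.ν₂ := by
  have hσ : θ.σ = θ'.σ := by simpa using h₂
  rw [hσ, div_left_inj' θ'.σ_pos.ne'] at h₁
  exact ⟨hσ, h₁, (Real.sqrt_inj θ.ν₂_pos.le θ'.ν₂_pos.le).1 h₁⟩

theorem params_eq_of_rho_pos {θ θ' : SLcnParam p q} {μ m μ' m' : ℝ}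
    (h : θ.outcomeDensity μ m = θ'.outcomeDensity μ' m') (hρ : 0 < θ.ρ) :
    μ = μ' ∧ m = m' ∧ θ.σ = θ'.σ ∧ θ.ρ = θ'.ρ ∧ θ.ν₁ = θ'.ν₁ ∧ θ.ν₂ = θ'.ν₂ := by
  have hρ' := rho_pos_of_outcomeDensity_eq h hρ
  have hk := θ.selectedNormalDensity_components_order.1
  have hk' := θ'.selectedNormalDensity_components_order.1
  have hr := θ.residualScale_pos
  have hr' := θ'.residualScale_pos
  have htop := θ.hasGaussTail_outcomeDensity_of_pos hρ μ m
  rw [h] at htop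
  obtain ⟨ha, hb, -, hC⟩ := htop.unique (θ'.hasGaussTail_outcomeDensity_of_pos hρ' μ' m')
  obtain ⟨hkk, rfl⟩ := location_eq_of_quadratic_eq hk hk' ha hb
  rw [← hkk] at hC
  have hν₁ : θ.ν₁ = θ'.ν₁ := mul_right_cancel₀
    (mul_pos (mul_pos hk (stdNormalPDF_pos _)) one_pos).ne' hC
  -- The left tail, through the reflected parameters, whose correlation is negative.
  obtain ⟨C, hbot⟩ := θ.reflect.hasGaussTail_outcomeDensity_of_neg (neg_lt_zero.2 hρ) (-μ) m
  obtain ⟨C', hbot'⟩ := θ'.reflect.hasGaussTail_outcomeDensity_of_neg (neg_lt_zero.2 hρ') (-μ) m'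
  rw [reflect_outcomeDensity_eq h] at hbot
  obtain ⟨ha', hb', -, -⟩ := hbot.unique hbot'
  simp only [residualScale_reflect] at ha' hb'
  simp only [reflect] at ha' hb'
  rw [← hkk] at ha' hb'
  -- With this identity the quadratic coefficient of the left tail is `k² / (2 (1 - ρ²))`; as `k` is
  -- known and `ρ > 0`, it gives `ρ`.
  have hone : ∀ θ : SLcnParam p q, 1 + (-θ.ρ / θ.residualScale) ^ 2 = (θ.residualScale ^ 2)⁻¹ := by
    intro θ
    have := θ.residualScale_pos
    have := θ.residualScale_sq
    field_simp
    linarith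
  have hrr : θ.residualScale ^ 2 = θ'.residualScale ^ 2 := by
    have h1 : (√θ.ν₂ / θ.σ) ^ 2 * (1 + (-θ.ρ / θ.residualScale) ^ 2) =
      (√θ.ν₂ / θ.σ) ^ 2 * (1 + (-θ'.ρ / θ'.residualScale) ^ 2) := by linarith
    have h2 := mul_left_cancel₀ (pow_pos hk 2).ne' h1
    rw [hone, hone] at h2
    exact inv_injective h2
  have hρρ : θ.ρ = θ'.ρ := by
    rw [residualScale_sq, residualScale_sq] at hrr
    exact (pow_left_inj₀ hρ.le hρ'.le two_ne_zero).1 (by linarith)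
  replace hrr : θ.residualScale = θ'.residualScale :=
    (pow_left_inj₀ hr.le hr'.le two_ne_zero).1 hrr
  rw [← hρρ, ← hrr] at hb'
  -- From the linear coefficient of the left tail, all its other ingredients being already matched.
  have hA : √θ.ν₂ * m = √θ'.ν₂ * m' := by
    have h1 := add_left_cancel hb'
    have h2 := mul_right_cancel₀ hk.ne' h1
    have h3 := mul_right_cancel₀ (div_neg_of_neg_of_pos (neg_lt_zero.2 hρ) hr).ne h2
    exact (div_left_inj' hr.ne').1 h3
  -- The wide components now coincide and cancel, as do the weights `1 - ν₁`, leaving the narrow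
  -- components to be compared.
  have hsnd : ∀ y, selectedNormalDensity (1 / θ.σ) μ (m / θ.residualScale)
      (θ.ρ / θ.residualScale) y = selectedNormalDensity (1 / θ'.σ) μ (m' / θ'.residualScale)
      (θ'.ρ / θ'.residualScale) y := by
    intro y
    have h1 := congrFun h y
    rw [outcomeDensity, outcomeDensity, hν₁, hkk, hρρ, hA, hrr] at h1
    rw [hρρ, hrr]
    exact mul_left_cancel₀ (sub_pos.2 θ'.ν₁_lt_one).ne' (add_left_cancel h1)
  have htop₂ := hasGaussTail_selectedNormalDensity_of_pos (one_div_pos.2 θ.σ_pos)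
    (div_pos hρ hr) μ (m / θ.residualScale)
  rw [funext hsnd] at htop₂
  obtain ⟨ha₂, hb₂, -, -⟩ := htop₂.unique (hasGaussTail_selectedNormalDensity_of_pos
    (one_div_pos.2 θ'.σ_pos) (div_pos hρ' hr') μ (m' / θ'.residualScale))
  obtain ⟨hσ, hs, hν₂⟩ := scales_eq hkk (location_eq_of_quadratic_eq (one_div_pos.2 θ.σ_pos)
    (one_div_pos.2 θ'.σ_pos) ha₂ hb₂).1
  rw [hs] at hA
  exact ⟨rfl, mul_left_cancel₀ (Real.sqrt_pos.2 θ'.ν₂_pos).ne' hA, hσ, hρρ, hν₁, hν₂⟩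

theorem params_eq_of_rho_eq_zero {θ θ' : SLcnParam p q} {μ m μ' m' : ℝ}
    (h : θ.outcomeDensity μ m = θ'.outcomeDensity μ' m') (hρ : θ.ρ = 0) (hρ' : θ'.ρ = 0) :
    μ = μ' ∧ m = m' ∧ θ.σ = θ'.σ ∧ θ.ρ = θ'.ρ ∧ θ.ν₁ = θ'.ν₁ ∧ θ.ν₂ = θ'.ν₂ := by
  have hk := θ.selectedNormalDensity_components_order.1
  have hk' := θ'.selectedNormalDensity_components_order.1
  have hr : θ.residualScale = 1 := by simp [residualScale, hρ]
  have hr' : θ'.residualScale = 1 := by simp [residualScale, hρ']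
  have htop := θ.hasGaussTail_outcomeDensity_of_eq_zero hρ μ m
  rw [h] at htop
  obtain ⟨ha, hb, -, hC⟩ := htop.unique (θ'.hasGaussTail_outcomeDensity_of_eq_zero hρ' μ' m')
  obtain ⟨hkk, rfl⟩ := location_eq_of_quadratic_eq hk hk' ha hb
  rw [← hkk, hr, hr', div_one, div_one, mul_left_comm, mul_left_comm θ'.ν₁] at hC
  replace hC := mul_left_cancel₀ (mul_pos hk (stdNormalPDF_pos _)).ne' hC
  have hsnd : ∀ y, (1 - θ.ν₁) * selectedNormalDensity (1 / θ.σ) μ m 0 y =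
      (1 - θ'.ν₁) * selectedNormalDensity (1 / θ'.σ) μ m' 0 y := by
    intro y
    have h1 := congrFun h y
    rw [outcomeDensity, outcomeDensity, hkk, hr, hr', hρ, hρ', zero_div, div_one, div_one, div_one,
      div_one] at h1
    -- With `ρ = 0` the factor `Φ` does not depend on `y`, so equality of the products `ν₁ Φ(√ν₂ m)`
    -- suffices to cancel the wide components.
    have h2 : θ.ν₁ * selectedNormalDensity (√θ'.ν₂ / θ'.σ) μ (√θ.ν₂ * m) 0 y =
        θ'.ν₁ * selectedNormalDensity (√θ'.ν₂ / θ'.σ) μ (√θ'.ν₂ * m') 0 y := by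
      simp only [selectedNormalDensity, zero_mul, add_zero]
      rw [mul_left_comm, hC, mul_left_comm]
    exact add_left_cancel (h2 ▸ h1)
  have htop₂ := (hasGaussTail_selectedNormalDensity_zero (one_div_pos.2 θ.σ_pos) μ m).const_mul
    (sub_pos.2 θ.ν₁_lt_one)
  rw [funext hsnd] at htop₂
  obtain ⟨ha₂, hb₂, -, hC₂⟩ := htop₂.unique ((hasGaussTail_selectedNormalDensity_zero
    (one_div_pos.2 θ'.σ_pos) μ m').const_mul (sub_pos.2 θ'.ν₁_lt_one))
  have hkk₂ := (location_eq_of_quadratic_eq (one_div_pos.2 θ.σ_pos)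
    (one_div_pos.2 θ'.σ_pos) ha₂ hb₂).1
  obtain ⟨hσ, hs, hν₂⟩ := scales_eq hkk hkk₂
  rw [← hkk₂, mul_left_comm, mul_left_comm (1 - θ'.ν₁)] at hC₂
  replace hC₂ := mul_left_cancel₀
    (mul_pos (one_div_pos.2 θ.σ_pos) (stdNormalPDF_pos _)).ne' hC₂
  rw [hs] at hC
  obtain ⟨hm, hν₁⟩ := mixing_eq (Real.sqrt_pos.2 θ'.ν₂_pos) θ.ν₁_pos θ.ν₁_lt_one θ'.ν₁_pos
    θ'.ν₁_lt_one hC hC₂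
  exact ⟨rfl, hm, hσ, hρ.trans hρ'.symm, hν₁, hν₂⟩

/-- The outcome density on the selected units determines the locations and the error law. -/
theorem params_eq_of_outcomeDensity_eq {θ θ' : SLcnParam p q} {μ m μ' m' : ℝ}
    (h : θ.outcomeDensity μ m = θ'.outcomeDensity μ' m') :
    μ = μ' ∧ m = m' ∧ θ.σ = θ'.σ ∧ θ.ρ = θ'.ρ ∧ θ.ν₁ = θ'.ν₁ ∧ θ.ν₂ = θ'.ν₂ := by
  rcases lt_trichotomy θ.ρ 0 with hρ | hρ | hρ
  · obtain ⟨h1, h2, h3, h4, h5, h6⟩ :=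
      params_eq_of_rho_pos (reflect_outcomeDensity_eq h) (neg_pos.2 hρ)
    exact ⟨neg_injective h1, h2, h3, neg_injective h4, h5, h6⟩
  · have hρ' : θ'.ρ = 0 := by
      rcases lt_trichotomy θ'.ρ 0 with h' | h' | h'
      · exact absurd hρ (rho_neg_of_outcomeDensity_eq h.symm h').ne
      · exact h'
      · exact absurd hρ (rho_pos_of_outcomeDensity_eq h.symm h').ne'
    exact params_eq_of_rho_eq_zero h hρ hρ'
  · exact params_eq_of_rho_pos h hρ

end SLcnParam

/-! ### From locations to regression coefficients -/

lemma Matrix.eq_of_row_dotProduct_eq {m n : ℕ} {X : Matrix (Fin m) (Fin n) ℝ} (hX : X.rank = n)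
    {u v : Fin n → ℝ} (h : ∀ i, X i ⬝ᵥ u = X i ⬝ᵥ v) : u = v := by
  have hker : LinearMap.ker X.mulVecLin = ⊥ := by
    have h1 := X.mulVecLin.finrank_range_add_finrank_ker
    rw [← Matrix.rank, hX, Module.finrank_fin_fun] at h1
    exact Submodule.finrank_eq_zero.1 (by omega)
  exact LinearMap.ker_eq_bot.1 hker (funext h)

theorem SLcnParam.isIdentifiable_sampleLaw {n p q : ℕ} {X : Matrix (Fin n) (Fin p) ℝ}
    {W : Matrix (Fin n) (Fin q) ℝ} (hn : 0 < n) (hX : X.rank = p) (hW : W.rank = q) :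
    IsIdentifiable (SLcnParam.sampleLaw X W) := by
  intro θ θ' h
  have key := fun i => params_eq_of_outcomeDensity_eq
    (outcomeDensity_eq_of_unitLaw_eq (unitLaw_eq_of_sampleLaw_eq h i))
  -- A single unit determines the error law; all units together are needed only for the
  -- coefficients.
  obtain ⟨-, -, hσ, hρ, hν₁, hν₂⟩ := key ⟨0, hn⟩
  exact SLcnParam.ext (Matrix.eq_of_row_dotProduct_eq hX fun i => (key i).1)
    (Matrix.eq_of_row_dotProduct_eq hW fun i => (key i).2.1) hσ hρ hν₁ hν₂

theorem theorem1 (n p q : ℕ) :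
    (∀ θ : SLcnParam p q,
      (∀ z : ℝ, θ.selectionErrorCDF z =
        θ.ν₁ * cdf (gaussianReal 0 (θ.ν₂⁻¹).toNNReal) z + (1 - θ.ν₁) * cdf (gaussianReal 0 1) z) ∧
      TailCondition1 θ.selectionErrorCDF ∧
      TailCondition2 θ.selectionErrorCDF ∧
      TailCondition3 θ.selectionErrorCDF) ∧
    (∀ (X : Matrix (Fin n) (Fin p) ℝ) (W : Matrix (Fin n) (Fin q) ℝ),
      0 < n → X.rank = p → W.rank = q →
      IsIdentifiable (SLcnParam.sampleLaw X W)) :=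
  ⟨fun θ => ⟨θ.selectionErrorCDF_eq, θ.tailConditions_selectionErrorCDF⟩,
    fun _ _ hn hX hW => SLcnParam.isIdentifiable_sampleLaw hn hX hW⟩
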